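/- Let $X_0$ be a chain or ring of smooth projective curves $C_0,\dots,C_{n-1}$ of genera $g_0,\dots,g_{n-1}\ge 0$: $C_{i-1}$ meets $C_i$ transversally in one point for $0<i<n$, and in a ring $C_{n-1}$ and $C_0$ meet in one more node. Let $g=\sum_i g_i$ for a chain and $g=1+\sum_i g_i$ for a ring, let $\pi_g=\langle a_1,b_1,\dots,a_g,b_g\mid\prod_k[a_k,b_k]=1\rangle$ be the fundamental group of a smooth curve $X_t$ of genus $g$ degenerating to $X_0$, and let $cr:X_t\to X_0$ be the contraction, which contracts one circle of $X_t$ to each node of $X_0$. Thus $\pi_1(X_0)$ is the free product of the groups $\pi_1(C_i)=\pi_{g_i}$ and, for a ring, of $\mathbb Z$; in a standard system of generators of $\pi_g$ adapted to $X_0$, the map $cr_*:\pi_g\to\pi_1(X_0)$ sends the handles belonging to $C_i$ to the standard generators of $\pi_1(C_i)$ and, for a ring, the remaining handle $(\alpha,\beta)$ to $(\tau,1)$, where $\tau$ generates $\mathbb Z$ and $\beta$ is a contracted circle. Let $Map(g)=\mathrm{Out}(\pi_g)$, and let $M_D\subset Map(g)$ be the subgroup of the classes of those $\varphi\in\mathrm{Aut}(\pi_g)$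 for which there is $\psi\in\mathrm{Aut}(\pi_1(X_0))$ with $cr_*\circ\varphi=\psi\circ cr_*$. Let $S_0\subset\pi_g$ consist of the classes of the contracted circles, one for each node of $X_0$, and let $S_1\subset\pi_g$ be any set of elements each of which is conjugate into one of the subgroups $\pi_1(cr^{-1}(C_i))$ (for instance, vanishing cycles of another singular fibre that are disjoint from the contracted circles). Let $\pi_g/(M_D s_i^3)$ be the quotient of $\pi_g$ by the normal subgroup generated by all $\varphi(s)^3$ with $s\in S_0\cup S_1$ and $\varphi\in\mathrm{Aut}(\pi_g)$ representing an element of $M_D$. For a group $G$ let $B_3(G)$ be the quotient of $G$ by the subgroup generated by the cubes of all its elements. If more than one component $C_i$ has positive genus, then $\pi_g/(M_D s_i^3)$ is infinite. Moreover, the groups $B_3(\pi_1(C_i))$ with $g_i>0$ are nontrivial, and the composition of $cr_*$ with the natural map from $\pi_1(X_0)$ to the free product $\ast_{g_i>0}B_3(\pi_1(C_i))$ (trivial on the factors $\pi_1(C_i)$ with $g_i=0$ and on $\mathbb Z$) induces a surjective homomorphism $$\pi_g/(M_D s_i^3)\longrightarrow \ast_{g_i>0}\,B_3(\pi_1(C_i)).$$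 -/

import Mathlib

open scoped commutatorElement

/-! ### Surface groups, mapping classes, Burnside type quotients -/

/-- The product `f 0 * f 1 * ⋯ * f (n - 1)`, in this order. -/
def orderedProd {G : Type*} [Monoid G] {n : ℕ} (f : Fin n → G) : G := (List.ofFn f).prod

/-- The word `[a₀, b₀] [a₁, b₁] ⋯ [a_{g-1}, b_{g-1}]`; the letters `a_k`, `b_k` are
`Sum.inl k`, `Sum.inr k`. -/
def surfaceRelator (g : ℕ) : FreeGroup (Fin g ⊕ Fin g) :=
  orderedProd fun k => ⁅(FreeGroup.of (Sum.inl k) : FreeGroup (Fin g ⊕ Fin g)),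
      (FreeGroup.of (Sum.inr k) : FreeGroup (Fin g ⊕ Fin g))⁆

/-- The fundamental group `π_g` of a closed orientable surface (smooth projective curve) of
genus `g`, in its standard presentation `⟨a_k, b_k | ∏ [a_k, b_k] = 1⟩`. -/
abbrev SurfaceGroup (g : ℕ) : Type := PresentedGroup ({surfaceRelator g} : Set (FreeGroup _))

namespace SurfaceGroup

/-- The standard generator `a_k`. -/
def a {g : ℕ} (k : Fin g) : SurfaceGroup g := PresentedGroup.of (Sum.inl k)

/-- The standard generator `b_k`. -/
def b {g : ℕ} (k : Fin g) : SurfaceGroup g := PresentedGroup.of (Sum.inr k)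

end SurfaceGroup

theorem map_orderedProd {G H : Type*} [Monoid G] [Monoid H] {n : ℕ} (φ : G →* H)
    (f : Fin n → G) : φ (orderedProd f) = orderedProd fun k => φ (f k) := by
  simp only [orderedProd, map_list_prod, List.map_ofFn]
  rfl

theorem SurfaceGroup.relation (g : ℕ) :
    orderedProd (fun k : Fin g => ⁅SurfaceGroup.a k, SurfaceGroup.b k⁆) = 1 := by
  have h : PresentedGroup.mk ({surfaceRelator g} : Set (FreeGroup _)) (surfaceRelator g) = 1 :=
    PresentedGroup.one_of_mem (Set.mem_singleton _)
  rw [surfaceRelator, map_orderedProd] at h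
  simpa only [map_commutatorElement] using! h

/-- Elements `x_k`, `y_k` of a group with `∏ [x_k, y_k] = 1` define a homomorphism from `π_g`. -/
def SurfaceGroup.lift {G : Type*} [Group G] {g : ℕ} (x y : Fin g → G)
    (h : orderedProd (fun k => ⁅x k, y k⁆) = 1) : SurfaceGroup g →* G :=
  PresentedGroup.toGroup (f := Sum.elim x y) (by
    rintro r rfl
    rw [surfaceRelator, map_orderedProd, ← h]
    simp only [map_commutatorElement, FreeGroup.lift_apply_of, Sum.elim_inl, Sum.elim_inr])

/-- Inner automorphisms form a normal subgroup. -/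
instance conjRangeNormal (G : Type*) [Group G] :
    (MulAut.conj : G →* MulAut G).range.Normal := by
  refine ⟨?_⟩
  rintro _ ⟨x, rfl⟩ φ
  refine ⟨φ x, ?_⟩
  ext y
  simp [MulAut.conj_apply]

/-- The mapping class group `Map(g)`, as the group of exterior automorphisms of `π_g`. -/
abbrev MappingClassGroup (g : ℕ) : Type :=
  MulAut (SurfaceGroup g) ⧸ (MulAut.conj : SurfaceGroup g →* MulAut (SurfaceGroup g)).range

/-- The normal subgroup of `π_g` generated by the orbits `M s ^ N`, `s ∈ S`. A mapping class acts
on conjugacy classes of `π_g`: the orbit of `s` under `M` is the set of all `φ s`, where the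
automorphism `φ` represents an element of `M`. -/
def burnsideKernel {g : ℕ} (M : Subgroup (MappingClassGroup g)) (S : Set (SurfaceGroup g))
    (N : ℕ) : Subgroup (SurfaceGroup g) :=
  Subgroup.normalClosure {y | ∃ s ∈ S, ∃ φ : MulAut (SurfaceGroup g),
    (φ : MappingClassGroup g) ∈ M ∧ y = φ s ^ N}

instance {g : ℕ} (M : Subgroup (MappingClassGroup g)) (S : Set (SurfaceGroup g)) (N : ℕ) :
    (burnsideKernel M S N).Normal := Subgroup.normalClosure_normal

/-- The Burnside type quotient `π_g / (M S ^ N)`. -/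
abbrev BurnsideTypeQuotient {g : ℕ} (M : Subgroup (MappingClassGroup g))
    (S : Set (SurfaceGroup g)) (N : ℕ) : Type :=
  SurfaceGroup g ⧸ burnsideKernel M S N

/-- The subgroup generated by all `N`-th powers. -/
def powerSubgroup (N : ℕ) (G : Type*) [Group G] : Subgroup G :=
  Subgroup.normalClosure (Set.range fun x : G => x ^ N)

instance (N : ℕ) (G : Type*) [Group G] : (powerSubgroup N G).Normal :=
  Subgroup.normalClosure_normal

/-- The largest quotient of `G` in which `x ^ N = 1` for all `x`. For a free group `G` of rank `k`
this is the Burnside group `B(k, N)`; for `G = π_g` it is the quotient of `B(2g, N)` by the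
surface relation. -/
abbrev BurnsideQuotient (N : ℕ) (G : Type*) [Group G] : Type _ := G ⧸ powerSubgroup N G

/-! ### Chains and rings of curves -/

/-- The topological type of a chain or ring of smooth curves `C_0, …, C_{n-1}`: in both cases
`C_{i-1}` meets `C_i` transversally in one point for `0 < i < n`; in a ring there is one more
node, joining `C_{n-1}` to `C_0`. -/
structure CurveChainOrRing where
  /-- the number of components -/
  n : ℕ
  /-- the genera of the components -/
  genus : Fin n → ℕ
  /-- `true` for a ring, `false` for a chain -/
  isRing : Bool

namespace CurveChainOrRing

variable (X : CurveChainOrRing)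

/-- The number of independent loops of the intersection graph of `X₀`. -/
def loops : ℕ := if X.isRing then 1 else 0

/-- The arithmetic genus of `X₀`, which is the genus of the generic fibre `X_t`. -/
def arithGenus : ℕ := (∑ i, X.genus i) + X.loops

/-- The fundamental group `π_g` of the generic fibre. Its handles are numbered as follows: first
the handles of `C_0`, then those of `C_1`, and so on; for a ring the last handle is the one that
runs once around the ring. -/
abbrev FiberGroup : Type := SurfaceGroup X.arithGenus

/-- The position, among all handles of `X_t`, of the `j`-th handle of the component `C_i`. -/
def handle (i : Fin X.n) (j : Fin (X.genus i)) : Fin X.arithGenus :=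
  Fin.castAdd X.loops (finSigmaFinEquiv ⟨i, j⟩)

/-- The last handle of `X_t`, which for a ring runs around the ring. -/
def loopHandle (l : Fin X.loops) : Fin X.arithGenus := Fin.natAdd (∑ i, X.genus i) l

/-- `∏_j [a_j, b_j]` over the handles of the component `C_i`. -/
def handleProd (i : Fin X.n) : X.FiberGroup :=
  orderedProd fun j : Fin (X.genus i) =>
    ⁅SurfaceGroup.a (X.handle i j), SurfaceGroup.b (X.handle i j)⁆

/-- The class of the circle of `X_t` over the node between `C_{k-1}` and `C_k`.
For a chain it is the curve `∏ [a, b]`, over the handles of `C_0, …, C_{k-1}`, which separates these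
handles from the others; it is trivial for `k = 0` and `k = n`. For a ring with loop handle `(α, β)`
it is `β⁻¹` times that product; the node between `C_{n-1}` and `C_0` appears twice, as
`β⁻¹` for `k = 0` and as `α * β⁻¹ * α⁻¹` for `k = n`. In both cases
`(nodeCycle i)⁻¹ * nodeCycle (i + 1)` is the product of commutators over the handles of `C_i`: the
part of `X_t` over `C_i` is a surface of genus `g(C_i)` bounded by these two circles. -/
def nodeCycle (k : ℕ) : X.FiberGroup :=
  (List.ofFn fun l : Fin X.loops => (SurfaceGroup.b (X.loopHandle l))⁻¹).prod *
    ((List.ofFn X.handleProd).take k).prod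

/-- The set `S₀` of vanishing cycles of `X₀`: one for each node. -/
def vanishingCycles : Set X.FiberGroup :=
  {s | ∃ k : ℕ, 0 < k ∧ (k < X.n ∨ (k = X.n ∧ X.isRing = true)) ∧ s = X.nodeCycle k}

/-- The subgroup `π₁(cr⁻¹(C_i))` of `π_g`: it is generated by the handles of `C_i` and by the
boundary circles of `cr⁻¹(C_i)`, which lie over the nodes on `C_i`. -/
def componentSubgroup (i : Fin X.n) : Subgroup X.FiberGroup :=
  Subgroup.closure
    ({s | ∃ j, s = SurfaceGroup.a (X.handle i j) ∨ s = SurfaceGroup.b (X.handle i j)} ∪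
      {X.nodeCycle i, X.nodeCycle (i + 1)})

/-- The fundamental group of `X₀`: the free product of the groups `π₁(C_i)` and of the (free)
fundamental group of the intersection graph. -/
abbrev NodalGroup : Type :=
  Monoid.Coprod (Monoid.CoprodI fun i : Fin X.n => SurfaceGroup (X.genus i))
    (FreeGroup (Fin X.loops))

/-- The inclusion of `π₁(C_i)` into `π₁(X₀)`. -/
def ofComponent (i : Fin X.n) : SurfaceGroup (X.genus i) →* X.NodalGroup :=
  Monoid.Coprod.inl.comp (Monoid.CoprodI.of (M := fun i : Fin X.n => SurfaceGroup (X.genus i)) (i := i))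

theorem prod_range_sum {G : Type*} [Monoid G] (f : ℕ → G) {m : ℕ} (n : Fin m → ℕ) :
    ((List.range (∑ i, n i)).map f).prod =
      orderedProd fun i : Fin m => orderedProd fun j : Fin (n i) =>
        f (∑ i' : Fin i, n (Fin.castLE i.2.le i') + j) := by
  induction m with
  | zero => simp [orderedProd]
  | succ m ih =>
    rw [Fin.sum_univ_castSucc, List.range_add, List.map_append, List.prod_append, ih]
    simp only [orderedProd]
    rw [List.ofFn_succ', List.prod_concat]
    congr 1
    rw [List.map_map, ← List.ofFn_getElem (xs := List.map _ _)]
    congr 1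
    apply List.ext_getElem
    · simp
    · intro k h1 h2
      simp
      rfl

theorem orderedProd_sum {G : Type*} [Monoid G] {m : ℕ} (n : Fin m → ℕ)
    (F : Fin (∑ i, n i) → G) :
    orderedProd F = orderedProd fun i => orderedProd fun j => F (finSigmaFinEquiv ⟨i, j⟩) := by
  have h := prod_range_sum (fun k => if h : k < ∑ i, n i then F ⟨k, h⟩ else 1) n
  have e : orderedProd F =
      ((List.range (∑ i, n i)).map fun k => if h : k < ∑ i, n i then F ⟨k, h⟩ else 1).prod := by
    rw [orderedProd]
    congr 1
    apply List.ext_getElem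
    · simp
    · intro k h1 h2
      have hk : k < ∑ i, n i := by simpa using h1
      simp [hk]
  rw [e, h]
  congr 1
  funext i
  congr 1
  funext j
  have hv : (finSigmaFinEquiv ⟨i, j⟩ : ℕ) =
      ∑ i' : Fin i, n (Fin.castLE i.2.le i') + j := finSigmaFinEquiv_apply (n := n) ⟨i, j⟩
  have hlt := (finSigmaFinEquiv ⟨i, j⟩).isLt
  rw [hv] at hlt
  rw [dif_pos hlt]
  congr 1
  exact Fin.ext hv.symm

theorem orderedProd_add {G : Type*} [Monoid G] {p q : ℕ} (F : Fin (p + q) → G) :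
    orderedProd F = orderedProd (fun k => F (Fin.castAdd q k)) *
      orderedProd (fun k => F (Fin.natAdd p k)) := by
  have h := List.ofFn_fin_append (fun k => F (Fin.castAdd q k)) (fun k => F (Fin.natAdd p k))
  rw [Fin.append_castAdd_natAdd] at h
  simp only [orderedProd]
  rw [h, List.prod_append]

theorem orderedProd_one {G : Type*} [Monoid G] {p : ℕ} {F : Fin p → G} (h : ∀ k, F k = 1) :
    orderedProd F = 1 := by
  apply List.prod_eq_one
  simp [h]

/-- A family of elements, one for each handle of `X_t`, from its values on the handles of the
components and on the loop handle. -/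
def onHandles {G : Type*} (u : ∀ i, Fin (X.genus i) → G) (v : Fin X.loops → G) :
    Fin X.arithGenus → G :=
  Fin.addCases (fun m => u (finSigmaFinEquiv.symm m).1 (finSigmaFinEquiv.symm m).2) v

@[simp] theorem onHandles_handle {G : Type*} (u : ∀ i, Fin (X.genus i) → G)
    (v : Fin X.loops → G) (i : Fin X.n) (j : Fin (X.genus i)) :
    X.onHandles u v (X.handle i j) = u i j := by
  have h : ∀ p : (i : Fin X.n) × Fin (X.genus i),
      X.onHandles u v (Fin.castAdd X.loops (finSigmaFinEquiv p)) = u p.1 p.2 := by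
    intro p
    refine (Fin.addCases_left (m := ∑ i, X.genus i) (n := X.loops) _).trans ?_
    rw [Equiv.symm_apply_apply]
  exact h ⟨i, j⟩

@[simp] theorem onHandles_loopHandle {G : Type*} (u : ∀ i, Fin (X.genus i) → G)
    (v : Fin X.loops → G) (l : Fin X.loops) :
    X.onHandles u v (X.loopHandle l) = v l :=
  Fin.addCases_right (m := ∑ i, X.genus i) (n := X.loops) _

/-- The homomorphism `cr : π_g → π₁(X₀)` induced by the contraction of the generic fibre onto `X₀`:
the handles of `C_i` go to the handles of `C_i`; the handle `(α, β)` of a ring goes to `(τ, 1)`,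
where `τ` is the loop of the intersection graph and `β` is a contracted circle. -/
def contraction : X.FiberGroup →* X.NodalGroup :=
  SurfaceGroup.lift
    (X.onHandles (fun i j => X.ofComponent i (SurfaceGroup.a j))
      (fun l => Monoid.Coprod.inr (FreeGroup.of l)))
    (X.onHandles (fun i j => X.ofComponent i (SurfaceGroup.b j)) (fun _ => 1))
    (by
      refine (orderedProd_add (p := ∑ i, X.genus i) (q := X.loops) _).trans ?_
      rw [orderedProd_sum]
      have h1 : ∀ l : Fin X.loops, ∀ x : X.NodalGroup, ⁅x, (1 : X.NodalGroup)⁆ = 1 :=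
        fun _ x => commutatorElement_one_right x
      have h2 : ∀ i : Fin X.n, (orderedProd fun j : Fin (X.genus i) =>
          ⁅X.ofComponent i (SurfaceGroup.a j), X.ofComponent i (SurfaceGroup.b j)⁆) = 1 := by
        intro i
        have := congrArg (X.ofComponent i) (SurfaceGroup.relation (X.genus i))
        rw [map_orderedProd, map_one] at this
        simpa only [map_commutatorElement] using this
      rw [orderedProd_one, orderedProd_one, mul_one]
      · intro l
        have := X.onHandles_loopHandle
          (fun i j => X.ofComponent i (SurfaceGroup.b j)) (fun _ => 1) l
        unfold loopHandle at this
        rw [this]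
        exact h1 l _
      · intro i
        rw [← h2 i]
        congr 1
        funext j
        exact congrArg₂ (fun x y => ⁅x, y⁆) (X.onHandles_handle _ _ i j)
          (X.onHandles_handle _ _ i j))

/-- The automorphisms of `π_g` that commute with the contraction, that is, that induce an
automorphism of `π₁(X₀)`. -/
def compatibleAut : Subgroup (MulAut X.FiberGroup) where
  carrier := {φ | ∃ ψ : MulAut X.NodalGroup, ∀ x, X.contraction (φ x) = ψ (X.contraction x)}
  one_mem' := ⟨1, fun _ => rfl⟩
  mul_mem' := by
    rintro φ φ' ⟨ψ, h⟩ ⟨ψ', h'⟩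
    exact ⟨ψ * ψ', fun x => by simp [h, h']⟩
  inv_mem' := by
    rintro φ ⟨ψ, h⟩
    refine ⟨ψ⁻¹, fun x => ?_⟩
    have := h (φ⁻¹ x)
    rw [MulAut.apply_inv_self] at this
    rw [this, MulAut.inv_apply_self]

/-- The group `M_D` of the mapping classes of `X_t` that commute with the contraction. -/
def MD : Subgroup (MappingClassGroup X.arithGenus) :=
  X.compatibleAut.map (QuotientGroup.mk' _)

/-- The free product of the exponent-`3` Burnside groups of the components of positive genus. -/
abbrev BurnsideFreeProduct : Type :=
  Monoid.CoprodI fun i : {i : Fin X.n // 0 < X.genus i} =>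
    BurnsideQuotient 3 (SurfaceGroup (X.genus i))

/-- The natural map from `π₁(X₀)` to the free product of the Burnside groups: it is the projection
on `π₁(C_i)` if `g(C_i) > 0`, and it is trivial on the other free factors. -/
def toBurnside : X.NodalGroup →* X.BurnsideFreeProduct :=
  Monoid.Coprod.lift
    (Monoid.CoprodI.lift fun i =>
      if h : 0 < X.genus i then
        (Monoid.CoprodI.of (M := fun i : {i : Fin X.n // 0 < X.genus i} =>
          BurnsideQuotient 3 (SurfaceGroup (X.genus i))) (i := ⟨i, h⟩)).comp
            (QuotientGroup.mk' (powerSubgroup 3 (SurfaceGroup (X.genus i))))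
      else 1)
    1

end CurveChainOrRing

/-!
The heart of the matter is that an automorphism `ψ` of `π₁(X₀)` maps each `π₁(C_i)` into a conjugate
of a free factor of `π₁(X₀)`. Given this, let `φ` represent an element of `M_D`, with induced
automorphism `ψ`. A contracted circle has trivial image under `cr ∘ φ = ψ ∘ cr`. An element that is
conjugate into `π₁(cr⁻¹(C_i))` has image conjugate into `ψ (π₁(C_i))`, hence into a free factor, and
its cube dies in the free product of the exponent-`3` quotients: the factors of genus zero and the
free factor of the intersection graph are killed. So the homomorphism to this free product exists
(`burnsideKernel_le_ker`). It is surjective since the standard generators are in the image, and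
the target is infinite, being a free product of at least two nontrivial groups; that `B₃(π_g)` is
nontrivial for `g > 0` is seen in `ℤ/3`.

For `π_g` with `g > 0` embedded by `θ` in a free product `Γ`, that `θ(π_g)` lies in a conjugate of a
factor is shown homologically, without trees or ends of groups.

* `SurfaceGroup.exists_eq_sub_of_isCrossedHom`: `H¹(π_g, ℤ[Γ]) = 0`. By Poincaré duality this is
  `H₁` of the universal cover of the surface. Concretely, a crossed homomorphism `d` is determined
  by the elements `d a_k`, `d b_k`, and the relation of `π_g` says, when it is written with the
  dual generators `x_k = P_k a_k b_k a_k⁻¹ P_k⁻¹` and `y_k = P_k [a_k, b_k] a_k⁻¹ P_k⁻¹`, where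
  `P_k` is the product of the commutators before `[a_k, b_k]`, that the elements `P_k d a_k`
  and `P_k a_k d b_k` are the coefficients of a `1`-cycle in the graph on `Γ` with edges `γ → x_k γ` and
  `γ → y_k γ`. This graph is a union of Cayley graphs of `π_g`, and all of its cycles are combinations of translates
  of the relator loop. To see this, let `Q` be the group of `1`-chains modulo the relator loops. The
  dual generators act on `Γ × Q` by moving along an edge in `Γ` and adding this edge in `Q`; this is
  an action of `π_g`, as the relator loops are zero in `Q` (`shearP_succ`, `exists_shear_action`).
  Its orbits are graphs of functions, which gives a potential `σ : Γ → Q` whose difference along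
  every edge is the class of this edge. So a `1`-cycle has class zero in `Q`.
* `Monoid.CoprodI.exists_conj_factor`: an infinite group `H ⊆ Γ` with `H¹(H, ℤ[Γ]) = 0` lies in
  a conjugate of a free factor. On `H`, the Fox derivation `d_j` attached to the factor `G_j` is
  `h ↦ w_j - h w_j` for some `w_j`. Since `∑ d_j γ = γ - 1`, the element `1 + ∑ w_j` is
  invariant under the infinite group `H`, so it is zero, and some `w_j` has nonzero augmentation.
  As `d_j` vanishes in `ℤ[Γ/G_j]`, the image of this `w_j` there is a nonzero invariant of `H`
  with finite support. So `H` has a finite orbit in `Γ/G_j`, and, since `G_j` is malnormal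
  (`Monoid.CoprodI.mem_range_of_of_conj_mem`), a fixed point.
-/

/-! ### Free products and crossed homomorphisms -/

section FreeProduct

open Monoid

variable {J : Type*} {G : J → Type*} [∀ j, Group (G j)]

theorem Monoid.CoprodI.Word.prod_injective :
    Function.Injective (CoprodI.Word.prod : CoprodI.Word G → CoprodI G) := by
  classical
  exact CoprodI.Word.equiv.symm.injective

theorem Monoid.CoprodI.NeWord.prod_ne_one {i j : J} (w : CoprodI.NeWord G i j) : w.prod ≠ 1 := by
  intro h
  have := CoprodI.Word.prod_injective (h.trans CoprodI.Word.prod_empty.symm)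
  exact w.toList_ne_nil (congrArg CoprodI.Word.toList this)

/-- A free factor is malnormal. -/
theorem Monoid.CoprodI.mem_range_of_of_conj_mem {j : J} {g : G j} (hg : g ≠ 1) {x : CoprodI G}
    (h : x * CoprodI.of g * x⁻¹ ∈ (CoprodI.of : G j →* CoprodI G).range) :
    x ∈ (CoprodI.of : G j →* CoprodI G).range := by
  classical
  obtain ⟨y, hy⟩ := h
  let p := CoprodI.Word.equivPair j (CoprodI.Word.equiv x⁻¹)
  have hx : x⁻¹ = CoprodI.of p.head * p.tail.prod := by
    rw [← CoprodI.Word.prod_rcons, ← CoprodI.Word.equivPair_symm, Equiv.symm_apply_apply]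
    exact (CoprodI.Word.equiv.symm_apply_apply x⁻¹).symm
  have hx' : x = p.tail.prod⁻¹ * (CoprodI.of p.head)⁻¹ := by
    rw [← inv_inv x, hx, mul_inv_rev]
  by_cases ht : p.tail = CoprodI.Word.empty
  · refine ⟨p.head⁻¹, ?_⟩
    rw [hx', ht, CoprodI.Word.prod_empty, map_inv, inv_one, one_mul]
  · exfalso
    obtain ⟨i, k, w, hw⟩ := CoprodI.NeWord.of_word _ ht
    have hij : i ≠ j := by
      intro hij
      apply p.fstIdx_ne
      rw [← hw]
      simp [CoprodI.Word.fstIdx, CoprodI.NeWord.toWord, hij]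
    have hg' : p.head⁻¹ * g * p.head ≠ 1 := by
      intro h1
      apply hg
      have := congrArg (fun z => p.head * z * p.head⁻¹) h1
      simpa [mul_assoc] using this
    have key : (CoprodI.NeWord.append (CoprodI.NeWord.append w.inv hij
        (CoprodI.NeWord.singleton _ hg')) hij.symm w).prod = CoprodI.of y := by
      have hwp : w.prod = p.tail.prod := by rw [CoprodI.NeWord.prod, hw]
      rw [hy, CoprodI.NeWord.append_prod, CoprodI.NeWord.append_prod, CoprodI.NeWord.inv_prod,
        CoprodI.NeWord.prod_singleton, hwp, hx, hx']
      simp only [map_mul, map_inv, mul_assoc]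
    by_cases hy1 : y = 1
    · rw [hy1, map_one] at key
      exact CoprodI.NeWord.prod_ne_one _ key
    · rw [← CoprodI.NeWord.prod_singleton y hy1] at key
      have := congrArg (fun v => v.toList.length) (CoprodI.Word.prod_injective key)
      simp only [CoprodI.NeWord.toWord, CoprodI.NeWord.toList, List.length_append,
        List.length_singleton] at this
      have := List.length_pos_of_ne_nil w.toList_ne_nil
      omega

/-- A free product with two nontrivial factors is infinite. -/
theorem Monoid.CoprodI.infinite {i j : J} (hij : i ≠ j) [Nontrivial (G i)] [Nontrivial (G j)] :
    Infinite (CoprodI G) := by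
  obtain ⟨x, hx⟩ := exists_ne (1 : G i)
  obtain ⟨y, hy⟩ := exists_ne (1 : G j)
  have h : ∀ n : ℕ, ∃ w : CoprodI.NeWord G i j,
      w.prod = (CoprodI.of x * CoprodI.of y) ^ (n + 1) := by
    intro n
    induction n with
    | zero =>
      exact ⟨.append (.singleton x hx) hij (.singleton y hy), by simp⟩
    | succ n ih =>
      obtain ⟨w, hw⟩ := ih
      refine ⟨.append (.append (.singleton x hx) hij (.singleton y hy)) hij.symm w, ?_⟩
      rw [pow_succ', ← hw]
      simp
  have h2 : ¬ IsOfFinOrder (CoprodI.of x * CoprodI.of y : CoprodI G) := by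
    rw [isOfFinOrder_iff_pow_eq_one]
    rintro ⟨n, hn, h1⟩
    obtain ⟨w, hw⟩ := h (n - 1)
    rw [Nat.sub_add_cancel hn, h1] at hw
    exact CoprodI.NeWord.prod_ne_one w hw
  exact Infinite.of_injective _ (injective_pow_iff_not_isOfFinOrder.2 h2)

/-- A crossed homomorphism (derivation) `d : H → ℤ[Γ]`, where `H` acts on `ℤ[Γ]` by left
multiplication through `θ : H → Γ`. -/
def IsCrossedHom {H Γ : Type*} [Group H] [Group Γ] (θ : H →* Γ) (d : H → MonoidAlgebra ℤ Γ) :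
    Prop :=
  ∀ p q, d (p * q) = d p + MonoidAlgebra.of ℤ Γ (θ p) * d q

theorem IsCrossedHom.map_one {H Γ : Type*} [Group H] [Group Γ] {θ : H →* Γ}
    {d : H → MonoidAlgebra ℤ Γ} (hd : IsCrossedHom θ d) : d 1 = 0 := by
  have := hd 1 1
  rwa [mul_one, _root_.map_one, _root_.map_one, one_mul, left_eq_add] at this

theorem IsCrossedHom.map_inv {H Γ : Type*} [Group H] [Group Γ] {θ : H →* Γ}
    {d : H → MonoidAlgebra ℤ Γ} (hd : IsCrossedHom θ d) (p : H) :
    d p⁻¹ = - (MonoidAlgebra.of ℤ Γ (θ p⁻¹) * d p) := by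
  have := hd p⁻¹ p
  rw [inv_mul_cancel, hd.map_one] at this
  exact eq_neg_of_add_eq_zero_left this.symm

variable (G) in
/-- The Fox derivation of a free product attached to the factor `G j`: the crossed homomorphism
that is `g ↦ g - 1` on `G j` and zero on the other factors. -/
theorem Monoid.CoprodI.exists_crossedHom (j : J) : ∃ d : CoprodI G → MonoidAlgebra ℤ (CoprodI G),
    IsCrossedHom (MonoidHom.id _) d ∧
    (∀ g : G j, d (CoprodI.of g) = MonoidAlgebra.of ℤ _ (CoprodI.of g) - 1) ∧
    ∀ i, i ≠ j → ∀ g : G i, d (CoprodI.of g) = 0 := by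
  classical
  -- On `G j` the action on `ℤ[Γ]` is the left multiplication conjugated by the translation by `1`,
  -- on the other factors it is the left multiplication itself.
  let t : J → MonoidAlgebra ℤ (CoprodI G) := fun i => if i = j then 1 else 0
  let A : CoprodI G →* Function.End (MonoidAlgebra ℤ (CoprodI G)) := CoprodI.lift fun i =>
    { toFun := fun g m => MonoidAlgebra.of ℤ _ (CoprodI.of g) * (m + t i) - t i
      map_one' := by
        funext m
        rw [_root_.map_one, _root_.map_one, one_mul, add_sub_cancel_right]
        rfl
      map_mul' := fun g h => by
        funext m
        rw [map_mul, map_mul]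
        change _ = MonoidAlgebra.of ℤ _ (CoprodI.of g) *
          ((MonoidAlgebra.of ℤ _ (CoprodI.of h) * (m + t i) - t i) + t i) - t i
        rw [sub_add_cancel, mul_assoc] }
  have hA : ∀ i (g : G i) m, A (CoprodI.of g) m =
      MonoidAlgebra.of ℤ _ (CoprodI.of g) * (m + t i) - t i := by
    intro i g m
    simp only [A, CoprodI.lift_of]
    rfl
  have haff : ∀ γ m, A γ m = MonoidAlgebra.of ℤ _ γ * m + A γ 0 := by
    intro γ
    induction γ using CoprodI.induction_on with
    | one =>
      intro m
      rw [_root_.map_one, _root_.map_one, one_mul]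
      change m = m + 0
      rw [add_zero]
    | of i g =>
      intro m
      rw [hA, hA, zero_add, mul_add]
      abel
    | mul x y hx hy =>
      intro m
      have e : ∀ m, A (x * y) m = A x (A y m) := fun m => by rw [map_mul]; rfl
      rw [e, e, hy, hx, hx (A y 0), map_mul, mul_add, mul_assoc]
      abel
  refine ⟨fun γ => A γ 0, ?_, ?_, ?_⟩
  · intro p q
    have e : A (p * q) 0 = A p (A q 0) := by rw [map_mul]; rfl
    change A (p * q) 0 = _
    rw [e, haff, add_comm]
    rfl
  · intro g
    change A _ 0 = _
    rw [hA]
    simp [t]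
  · intro i hi g
    change A _ 0 = _
    rw [hA]
    simp [t, hi]

/-- A finitely supported function on `Γ` that is invariant under an infinite subgroup is zero. -/
theorem MonoidAlgebra.eq_zero_of_forall_mul_eq {H Γ : Type*} [Group H] [Infinite H] [Group Γ]
    {θ : H →* Γ} (hθ : Function.Injective θ) {m : MonoidAlgebra ℤ Γ}
    (hm : ∀ h, MonoidAlgebra.of ℤ Γ (θ h) * m = m) : m = 0 := by
  by_contra h0
  have hc : m.coeff ≠ 0 := fun h => h0 (by ext x; simp [h])
  obtain ⟨γ, hγ⟩ := Finsupp.ne_iff.1 hc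
  have hs : ∀ h : H, θ h * γ ∈ m.coeff.support := by
    intro h
    rw [Finsupp.mem_support_iff]
    rw [← hm h]
    simpa using hγ
  have : Function.Injective fun h : H => (⟨θ h * γ, hs h⟩ : m.coeff.support) := by
    intro h h' e
    exact hθ (mul_right_cancel (Subtype.ext_iff.1 e))
  exact not_injective_infinite_finite _ this

/-- The projection of `ℤ[Γ]` to the finitely supported functions on the cosets of a subgroup. -/
noncomputable def MonoidAlgebra.toCosets {Γ : Type*} [Group Γ] (K : Subgroup Γ) :
    MonoidAlgebra ℤ Γ →+ ((Γ ⧸ K) →₀ ℤ) where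
  toFun m := m.coeff.mapDomain (QuotientGroup.mk : Γ → Γ ⧸ K)
  map_zero' := by rw [MonoidAlgebra.coeff_zero, Finsupp.mapDomain_zero]
  map_add' m m' := by rw [MonoidAlgebra.coeff_add, Finsupp.mapDomain_add]

theorem MonoidAlgebra.toCosets_of {Γ : Type*} [Group Γ] (K : Subgroup Γ) (γ : Γ) :
    MonoidAlgebra.toCosets K (MonoidAlgebra.of ℤ Γ γ) = Finsupp.single (γ : Γ ⧸ K) 1 := by
  simp [MonoidAlgebra.toCosets]

theorem MonoidAlgebra.toCosets_of_mul {Γ : Type*} [Group Γ] (K : Subgroup Γ) (γ : Γ)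
    (m : MonoidAlgebra ℤ Γ) : MonoidAlgebra.toCosets K (MonoidAlgebra.of ℤ Γ γ * m) =
      (MonoidAlgebra.toCosets K m).mapDomain (γ • ·) := by
  induction m using MonoidAlgebra.induction_linear with
  | zero => simp
  | add x y hx hy => rw [mul_add, map_add, hx, hy, map_add, Finsupp.mapDomain_add]
  | single γ' n => simp [MonoidAlgebra.toCosets]

theorem MonoidAlgebra.degree_toCosets {Γ : Type*} [Group Γ] (K : Subgroup Γ)
    (m : MonoidAlgebra ℤ Γ) : (MonoidAlgebra.toCosets K m).degree = m.coeff.degree := by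
  induction m using MonoidAlgebra.induction_linear with
  | zero => simp
  | add x y hx hy => rw [map_add, map_add, hx, hy, MonoidAlgebra.coeff_add, map_add]
  | single γ' n => simp [MonoidAlgebra.toCosets]

/-- An infinite group `H` with `H¹(H, ℤ[Γ]) = 0` that is embedded in a free product `Γ` of finitely
many groups is conjugate into one of the factors. -/
theorem Monoid.CoprodI.exists_conj_factor [Finite J] {H : Type*} [Group H] [Infinite H]
    {θ : H →* CoprodI G} (hθ : Function.Injective θ)
    (h1 : ∀ d, IsCrossedHom θ d → ∃ w, ∀ p, d p = w - MonoidAlgebra.of ℤ _ (θ p) * w) :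
    ∃ (j : J) (γ : CoprodI G), ∀ h, γ⁻¹ * θ h * γ ∈ (CoprodI.of : G j →* CoprodI G).range := by
  classical
  cases nonempty_fintype J
  choose d hd hdj hdi using CoprodI.exists_crossedHom G
  have hsum : ∀ γ, ∑ j, d j γ = MonoidAlgebra.of ℤ _ γ - 1 := by
    intro γ
    induction γ using CoprodI.induction_on with
    | one => simp only [(hd _).map_one, Finset.sum_const_zero, _root_.map_one, sub_self]
    | of i g =>
      rw [Finset.sum_eq_single i (fun j _ hj => hdi j i hj.symm g) (by simp), hdj]
    | mul x y hx hy =>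
      simp only [hd _ x y, Finset.sum_add_distrib, ← Finset.mul_sum, hx, hy, MonoidHom.id_apply,
        map_mul]
      noncomm_ring
  have hw : ∀ j, ∃ w, ∀ h, d j (θ h) = w - MonoidAlgebra.of ℤ _ (θ h) * w := fun j =>
    h1 (fun h => d j (θ h)) fun p q => by
      change d j (θ (p * q)) = _
      rw [map_mul, hd]; rfl
  choose w hw using hw
  have hW : (∑ j, w j) + 1 = 0 := by
    apply MonoidAlgebra.eq_zero_of_forall_mul_eq hθ
    intro h
    have e := hsum (θ h)
    simp only [hw, Finset.sum_sub_distrib, ← Finset.mul_sum] at e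
    rw [mul_add, mul_one]
    rw [sub_eq_sub_iff_add_eq_add] at e
    rw [add_comm, e]
  -- Project `ℤ[Γ]` to the functions on the cosets of the `j`-th factor, where `d j` vanishes.
  have hinv : ∀ j h, MonoidAlgebra.toCosets (CoprodI.of : G j →* CoprodI G).range
      (MonoidAlgebra.of ℤ _ (θ h) * w j) = MonoidAlgebra.toCosets _ (w j) := by
    intro j h
    have hz : ∀ γ, MonoidAlgebra.toCosets (CoprodI.of : G j →* CoprodI G).range (d j γ) = 0 := by
      intro γ
      induction γ using CoprodI.induction_on with
      | one => rw [(hd j).map_one, map_zero]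
      | of i g =>
        by_cases hij : i = j
        · subst hij
          rw [hdj, map_sub, ← _root_.map_one (MonoidAlgebra.of ℤ (CoprodI G)),
            MonoidAlgebra.toCosets_of, MonoidAlgebra.toCosets_of, sub_eq_zero]
          congr 1
          rw [eq_comm, QuotientGroup.eq]
          simp
        · rw [hdi j i hij, map_zero]
      | mul x y hx hy =>
        rw [hd j x y, map_add, hx, zero_add, MonoidHom.id_apply, MonoidAlgebra.toCosets_of_mul, hy,
          Finsupp.mapDomain_zero]
    have := hz (θ h)
    rw [hw, map_sub, sub_eq_zero] at this
    exact this.symm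
  have hne : ∃ j, MonoidAlgebra.toCosets (CoprodI.of : G j →* CoprodI G).range (w j) ≠ 0 := by
    by_contra! h0
    have e : Finsupp.degree ((∑ j, w j) + 1).coeff = 1 := by
      rw [MonoidAlgebra.coeff_add, map_add, MonoidAlgebra.coeff_sum, map_sum,
        Finset.sum_eq_zero]
      · simp [MonoidAlgebra.one_def]
      · intro j _
        rw [← MonoidAlgebra.degree_toCosets (CoprodI.of : G j →* CoprodI G).range, h0 j, map_zero]
    rw [hW] at e
    simp at e
  obtain ⟨j, hj⟩ := hne
  obtain ⟨q, hq⟩ := Finsupp.ne_iff.1 hj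
  have hs : ∀ h, θ h • q ∈ (MonoidAlgebra.toCosets _ (w j)).support := by
    intro h
    rw [Finsupp.mem_support_iff, ← hinv j h, MonoidAlgebra.toCosets_of_mul,
      Finsupp.mapDomain_apply (MulAction.injective _)]
    exact hq
  induction q using QuotientGroup.induction_on with | H γ => ?_
  refine ⟨j, γ, fun h => ?_⟩
  -- An element `k ≠ 1` of `H` fixes both cosets `γ G j` and `h γ G j`, by the pigeonhole principle.
  obtain ⟨k, k', hk, e⟩ := Finite.exists_ne_map_eq_of_infinite fun k : H =>
    ((⟨_, hs k⟩, ⟨_, hs (k * h)⟩) :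
      (MonoidAlgebra.toCosets (CoprodI.of : G j →* CoprodI G).range (w j)).support ×
      (MonoidAlgebra.toCosets (CoprodI.of : G j →* CoprodI G).range (w j)).support)
  rw [Prod.mk.injEq, Subtype.mk.injEq, Subtype.mk.injEq, MulAction.Quotient.smul_mk,
    MulAction.Quotient.smul_mk, MulAction.Quotient.smul_mk, MulAction.Quotient.smul_mk,
    QuotientGroup.eq, QuotientGroup.eq] at e
  simp only [smul_eq_mul, map_mul] at e
  obtain ⟨⟨g, hg⟩, e2⟩ := e
  have hg1 : g ≠ 1 := by
    rintro rfl
    apply hk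
    apply hθ
    rw [_root_.map_one, eq_comm, inv_mul_eq_one] at hg
    exact mul_right_cancel hg
  rw [← inv_mem_iff]
  refine CoprodI.mem_range_of_of_conj_mem hg1 ?_
  rw [hg]
  convert e2 using 1
  group

end FreeProduct

/-! ### Crossed homomorphisms of surface groups are principal -/

section SurfaceCohomology

/-- For a group acting on `Γ × Q` over an injective `θ : H → Γ`, each `H`-orbit is the graph of a
function on a coset of `H`; thus there is an equivariant section `Γ → Q`. -/
theorem exists_equivariant_section {H Γ Q : Type*} [Group H] [Group Γ] (q₀ : Q) {θ : H →* Γ}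
    (hθ : Function.Injective θ) (Φ : H →* Equiv.Perm (Γ × Q))
    (hΦ : ∀ p z, (Φ p z).1 = θ p * z.1) :
    ∃ σ : Γ → Q, ∀ p γ, Φ p (γ, σ γ) = (θ p * γ, σ (θ p * γ)) := by
  let r : Γ → Γ := fun γ => (Quotient.mk (QuotientGroup.rightRel θ.range) γ).out
  have hr : ∀ p γ, r (θ p * γ) = r γ := by
    intro p γ
    have : (Quotient.mk (QuotientGroup.rightRel θ.range) (θ p * γ)) = Quotient.mk _ γ := by
      apply Quotient.sound
      refine QuotientGroup.rightRel_apply.2 ⟨p⁻¹, ?_⟩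
      rw [map_inv]
      group
    simp only [r, this]
  have hp : ∀ γ, ∃ p, θ p * r γ = γ := by
    intro γ
    obtain ⟨p, hp⟩ := QuotientGroup.rightRel_apply.1
      (Quotient.mk_out (s := QuotientGroup.rightRel θ.range) γ)
    exact ⟨p, by rw [hp]; exact inv_mul_cancel_right _ _⟩
  choose c hc using hp
  have h1 : ∀ γ, Φ (c γ) (r γ, q₀) = (γ, (Φ (c γ) (r γ, q₀)).2) := fun γ =>
    Prod.ext (by rw [hΦ, hc]) rfl
  refine ⟨fun γ => (Φ (c γ) (r γ, q₀)).2, fun p γ => ?_⟩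
  have h2 : c (θ p * γ) = p * c γ := by
    apply hθ
    apply mul_right_cancel (b := r γ)
    rw [map_mul, mul_assoc, hc, ← hr p γ, hc]
  rw [← h1, ← Equiv.Perm.mul_apply, ← map_mul, ← h2, ← hr p γ]
  exact h1 _

/-- The permutation `(γ, q) ↦ (p * γ, q + α γ)` of `Γ × Q`. -/
def shear {Γ Q : Type*} [Group Γ] [AddCommGroup Q] (p : Γ) (α : Γ → Q) : Equiv.Perm (Γ × Q) where
  toFun z := (p * z.1, z.2 + α z.1)
  invFun z := (p⁻¹ * z.1, z.2 - α (p⁻¹ * z.1))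
  left_inv z := by simp
  right_inv z := by simp

theorem shear_apply {Γ Q : Type*} [Group Γ] [AddCommGroup Q] (p : Γ) (α : Γ → Q) (z : Γ × Q) :
    shear p α z = (p * z.1, z.2 + α z.1) := rfl

theorem shear_inv_apply {Γ Q : Type*} [Group Γ] [AddCommGroup Q] (p : Γ) (α : Γ → Q) (z : Γ × Q) :
    (shear p α)⁻¹ z = (p⁻¹ * z.1, z.2 - α (p⁻¹ * z.1)) := rfl

theorem prod_take_ofFn_succ {M : Type*} [Monoid M] {n : ℕ} (f : Fin n → M) (k : Fin n) :
    ((List.ofFn f).take (k + 1)).prod = ((List.ofFn f).take k).prod * f k := by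
  rw [List.prod_take_succ _ _ (by simp)]
  simp

theorem sum_take_ofFn_succ {M : Type*} [AddMonoid M] {n : ℕ} (f : Fin n → M) (k : Fin n) :
    ((List.ofFn f).take (k + 1)).sum = ((List.ofFn f).take k).sum + f k := by
  rw [List.sum_take_succ _ _ (by simp)]
  simp

theorem eq_mul_prod_take_ofFn {M : Type*} [Monoid M] {n : ℕ} (f : Fin n → M) (T : ℕ → M)
    (hT : ∀ k : Fin n, T (k + 1) = T k * f k) (m : ℕ) (hm : m ≤ n) :
    T m = T 0 * ((List.ofFn f).take m).prod := by
  induction m with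
  | zero => simp
  | succ m ih =>
    rw [hT ⟨m, hm⟩, prod_take_ofFn_succ f ⟨m, hm⟩, ← mul_assoc]
    exact congrArg (· * _) (ih (Nat.le_of_succ_le hm))

namespace SurfaceGroup

theorem closure_generators (g : ℕ) : Subgroup.closure
    (Set.range (a : Fin g → SurfaceGroup g) ∪ Set.range (b : Fin g → SurfaceGroup g)) = ⊤ := by
  rw [← PresentedGroup.closure_range_of]
  congr 1
  ext x
  constructor
  · rintro (⟨k, rfl⟩ | ⟨k, rfl⟩)
    · exact ⟨Sum.inl k, rfl⟩
    · exact ⟨Sum.inr k, rfl⟩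
  · rintro ⟨k | k, rfl⟩
    · exact Or.inl ⟨k, rfl⟩
    · exact Or.inr ⟨k, rfl⟩

theorem eq_top_of_mem {g : ℕ} (K : Subgroup (SurfaceGroup g)) (ha : ∀ k, a k ∈ K)
    (hb : ∀ k, b k ∈ K) : K = ⊤ := by
  rw [eq_top_iff, ← closure_generators, Subgroup.closure_le]
  rintro x (⟨k, rfl⟩ | ⟨k, rfl⟩)
  · exact ha k
  · exact hb k

@[simp] theorem lift_a {G : Type*} [Group G] {g : ℕ} (x y : Fin g → G)
    (h : orderedProd (fun k => ⁅x k, y k⁆) = 1) (k : Fin g) : lift x y h (a k) = x k :=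
  PresentedGroup.toGroup.of _

@[simp] theorem lift_b {G : Type*} [Group G] {g : ℕ} (x y : Fin g → G)
    (h : orderedProd (fun k => ⁅x k, y k⁆) = 1) (k : Fin g) : lift x y h (b k) = y k :=
  PresentedGroup.toGroup.of _

/-- The partial product `[a₀, b₀] ⋯ [a_{m-1}, b_{m-1}]`. -/
def partialRelator (g m : ℕ) : SurfaceGroup g :=
  ((List.ofFn fun k : Fin g => ⁅a k, b k⁆).take m).prod

theorem partialRelator_zero (g : ℕ) : partialRelator g 0 = 1 := by
  simp [partialRelator]

theorem partialRelator_succ {g : ℕ} (k : Fin g) :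
    partialRelator g (k + 1) = partialRelator g k * ⁅a k, b k⁆ :=
  prod_take_ofFn_succ _ k

theorem partialRelator_self (g : ℕ) : partialRelator g g = 1 := by
  rw [partialRelator, List.take_of_length_le (by simp)]
  exact relation g

/-- A dual family of generators, `P_k a_k b_k a_k⁻¹ P_k⁻¹`. -/
def dualA {g : ℕ} (k : Fin g) : SurfaceGroup g :=
  partialRelator g k * (a k * b k * (a k)⁻¹) * (partialRelator g k)⁻¹

/-- A dual family of generators, `P_k [a_k, b_k] a_k⁻¹ P_k⁻¹`. -/
def dualB {g : ℕ} (k : Fin g) : SurfaceGroup g :=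
  partialRelator g k * (⁅a k, b k⁆ * (a k)⁻¹) * (partialRelator g k)⁻¹

variable {g : ℕ} {Γ : Type*} [Group Γ] (θ : SurfaceGroup g →* Γ)

local notation "ι" => MonoidAlgebra.of ℤ Γ

/-- The family of the elements `(1 - s) w`, over the standard generators `s`. -/
noncomputable def coboundary :
    MonoidAlgebra ℤ Γ →+ (Fin g ⊕ Fin g → MonoidAlgebra ℤ Γ) where
  toFun w := Sum.elim (fun k => (1 - ι (θ (a k))) * w) (fun k => (1 - ι (θ (b k))) * w)
  map_zero' := by
    ext (k | k) <;> simp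
  map_add' w w' := by
    funext k
    rcases k with k | k <;> simp [mul_add]

/-- The families of elements of `ℤ[Γ]`, over the standard generators, up to those that belong to
principal crossed homomorphisms. -/
abbrev CochainQuotient : Type _ :=
  (Fin g ⊕ Fin g → MonoidAlgebra ℤ Γ) ⧸ (coboundary θ).range

/-- The class of the family with the single component `m`. In terms of the graph on `Γ` with edges
`γ → dualA k * γ` and `γ → dualB k * γ`, the class for `m = γ` is that of the edge of type `dualA k`
from `P_k γ`, respectively of type `dualB k` from `P_k a_k γ`, where `P_k = partialRelator g k`.
In these coordinates the relator loop based at `γ` is `coboundary θ γ`. -/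
noncomputable def cochainSingle (i : Fin g ⊕ Fin g) : MonoidAlgebra ℤ Γ →+ CochainQuotient θ :=
  (QuotientAddGroup.mk' _).comp (AddMonoidHom.single (fun _ => MonoidAlgebra ℤ Γ) i)

theorem sum_cochainSingle (u v : Fin g → MonoidAlgebra ℤ Γ) :
    ∑ k, (cochainSingle θ (Sum.inl k) (u k) + cochainSingle θ (Sum.inr k) (v k)) =
      QuotientAddGroup.mk' _ (Sum.elim u v) := by
  have := Finset.univ_sum_single (Sum.elim u v)
  rw [← this, map_sum, Fintype.sum_sum_type, Finset.sum_add_distrib]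
  rfl

/-- The sum of the first `m` handles' components of the coboundary of `γ`. -/
noncomputable def partialCoboundary (m : ℕ) (γ : Γ) : CochainQuotient θ :=
  ((List.ofFn fun k : Fin g => cochainSingle θ (Sum.inl k) ((1 - ι (θ (a k))) * ι γ) +
    cochainSingle θ (Sum.inr k) ((1 - ι (θ (b k))) * ι γ)).take m).sum

theorem partialCoboundary_succ (k : Fin g) (γ : Γ) :
    partialCoboundary θ (k + 1) γ = partialCoboundary θ k γ +
      (cochainSingle θ (Sum.inl k) ((1 - ι (θ (a k))) * ι γ) +
      cochainSingle θ (Sum.inr k) ((1 - ι (θ (b k))) * ι γ)) :=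
  sum_take_ofFn_succ _ k

theorem partialCoboundary_self (γ : Γ) : partialCoboundary θ g γ = 0 := by
  rw [partialCoboundary, List.take_of_length_le (by simp), List.sum_ofFn, sum_cochainSingle]
  exact (QuotientAddGroup.eq_zero_iff _).2 ⟨ι γ, rfl⟩

/-- The action of the dual generator `dualA k` on `Γ × Q`. -/
noncomputable def shearA (k : Fin g) : Equiv.Perm (Γ × CochainQuotient θ) :=
  shear (θ (dualA k)) fun γ => cochainSingle θ (Sum.inl k) (ι ((θ (partialRelator g k))⁻¹ * γ))

/-- The action of the dual generator `dualB k` on `Γ × Q`. -/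
noncomputable def shearB (k : Fin g) : Equiv.Perm (Γ × CochainQuotient θ) :=
  shear (θ (dualB k)) fun γ =>
    cochainSingle θ (Sum.inr k) (ι ((θ (a k))⁻¹ * (θ (partialRelator g k))⁻¹ * γ))

/-- The action of `partialRelator g m` on `Γ × Q`. -/
noncomputable def shearP (m : ℕ) : Equiv.Perm (Γ × CochainQuotient θ) :=
  shear (θ (partialRelator g m)) (partialCoboundary θ m)

theorem shearP_zero : shearP θ 0 = 1 := by
  ext z
  · simp [shearP, shear_apply, partialRelator_zero]
  · simp [shearP, shear_apply, partialCoboundary]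

theorem shearP_self : shearP θ g = 1 := by
  ext z
  · simp [shearP, shear_apply, partialRelator_self]
  · simp [shearP, shear_apply, partialCoboundary_self]

/-- Reading the word `y_k x_k⁻¹ y_k⁻¹ x_k`, which is `P_k [a_k, b_k] P_k⁻¹`, along the edges of the
graph gives the part of the coboundary that belongs to the `k`-th handle. -/
theorem shearP_succ (k : Fin g) : shearP θ (k + 1) =
    shearB θ k * (shearA θ k)⁻¹ * (shearB θ k)⁻¹ * shearA θ k * shearP θ k := by
  have hA : θ (dualA k) = θ (partialRelator g k) * (θ (a k) * θ (b k) * (θ (a k))⁻¹) *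
      (θ (partialRelator g k))⁻¹ := by
    simp only [dualA, map_mul, map_inv]
  have hB : θ (dualB k) = θ (partialRelator g k) * (θ (a k) * θ (b k) * (θ (a k))⁻¹ *
      (θ (b k))⁻¹ * (θ (a k))⁻¹) * (θ (partialRelator g k))⁻¹ := by
    simp only [dualB, commutatorElement_def, map_mul, map_inv]
  have hP : θ (partialRelator g (k + 1)) = θ (partialRelator g k) *
      (θ (a k) * θ (b k) * (θ (a k))⁻¹ * (θ (b k))⁻¹) := by
    simp only [partialRelator_succ, commutatorElement_def, map_mul, map_inv]
  apply Equiv.ext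
  rintro ⟨γ, q⟩
  simp only [Equiv.Perm.mul_apply, shearP, shearA, shearB, shear_apply, shear_inv_apply,
    partialCoboundary_succ, hA, hB, hP]
  generalize θ (partialRelator g k) = P
  generalize hx : θ (a k) = A
  generalize hy : θ (b k) = B
  refine Prod.ext (by group) ?_
  simp only
  -- The four edges of the path start or end, in the coordinates of `cochainSingle`, at `γ`, `B γ`,
  -- `A γ` and `γ`.
  rw [show P⁻¹ * (P * γ) = γ by group]
  rw [show A⁻¹ * P⁻¹ * ((P * (A * B * A⁻¹ * B⁻¹ * A⁻¹) * P⁻¹)⁻¹ *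
    (P * (A * B * A⁻¹) * P⁻¹ * (P * γ))) = B * γ by group]
  rw [show P⁻¹ * ((P * (A * B * A⁻¹) * P⁻¹)⁻¹ * ((P * (A * B * A⁻¹ * B⁻¹ * A⁻¹) * P⁻¹)⁻¹ *
    (P * (A * B * A⁻¹) * P⁻¹ * (P * γ)))) = A * γ by group]
  rw [show A⁻¹ * P⁻¹ * ((P * (A * B * A⁻¹) * P⁻¹)⁻¹ * ((P * (A * B * A⁻¹ * B⁻¹ * A⁻¹) * P⁻¹)⁻¹ *
    (P * (A * B * A⁻¹) * P⁻¹ * (P * γ)))) = γ by group]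
  simp only [sub_mul, one_mul, map_sub, map_mul]
  abel

/-- The action of `π_g` on `Γ × Q` in which the dual generators act by the shears. -/
theorem exists_shear_action : ∃ Φ : SurfaceGroup g →* Equiv.Perm (Γ × CochainQuotient θ),
    (∀ p z, (Φ p z).1 = θ p * z.1) ∧
    (∀ k, Φ (dualA k) = shearA θ k) ∧ (∀ k, Φ (dualB k) = shearB θ k) := by
  let T := shearP θ
  let x := shearA θ
  let y := shearB θ
  -- These words express `a_k` and `b_k` by the dual generators: if `x = a b a⁻¹` and
  -- `y = [a, b] a⁻¹`, then `a = x⁻¹ y⁻¹ x` and `b = x⁻¹ y x y⁻¹ x`.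
  let α : Fin g → Equiv.Perm (Γ × CochainQuotient θ) := fun k =>
    (T k)⁻¹ * ((x k)⁻¹ * (y k)⁻¹ * x k) * T k
  let β : Fin g → Equiv.Perm (Γ × CochainQuotient θ) := fun k =>
    (T k)⁻¹ * ((x k)⁻¹ * y k * x k * (y k)⁻¹ * x k) * T k
  have hT : ∀ k : Fin g, T (k + 1) = T k * ⁅α k, β k⁆ := by
    intro k
    rw [show T (k + 1) = _ from shearP_succ θ k]
    simp only [α, β, x, y, T, commutatorElement_def]
    group
  have h : orderedProd (fun k => ⁅α k, β k⁆) = 1 := by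
    have := eq_mul_prod_take_ofFn _ T hT g le_rfl
    rw [List.take_of_length_le (by simp)] at this
    simp only [T, shearP_zero, shearP_self, one_mul] at this
    exact this.symm
  let Φ := lift α β h
  have ha : ∀ k, Φ (a k) = α k := fun k => lift_a _ _ h k
  have hb : ∀ k, Φ (b k) = β k := fun k => lift_b _ _ h k
  have hP : ∀ m ≤ g, Φ (partialRelator g m) = T m := by
    intro m hm
    rw [eq_mul_prod_take_ofFn _ T hT m hm, eq_mul_prod_take_ofFn (fun k => ⁅α k, β k⁆)
      (fun m => Φ (partialRelator g m)) ?_ m hm]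
    · simp [T, shearP_zero, partialRelator_zero]
    · intro k
      simp only [partialRelator_succ, map_mul, map_commutatorElement, ha, hb]
  refine ⟨Φ, ?_, ?_, ?_⟩
  · let K : Subgroup (SurfaceGroup g) :=
      { carrier := {p | ∀ z, (Φ p z).1 = θ p * z.1}
        one_mem' := fun z => by simp
        mul_mem' := fun {p q} hp hq z => by
          rw [map_mul, Equiv.Perm.mul_apply, hp, hq, map_mul, mul_assoc]
        inv_mem' := fun {p} hp z => by
          have := hp (Φ p⁻¹ z)
          rw [← Equiv.Perm.mul_apply, ← map_mul, mul_inv_cancel, map_one, Equiv.Perm.one_apply] at this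
          rw [this, map_inv θ, inv_mul_cancel_left] }
    have hK : K = ⊤ := by
      apply eq_top_of_mem
      · intro k z
        rw [ha]
        simp only [α, x, y, T, Equiv.Perm.mul_apply, shearP, shearA, shearB, shear_apply,
          shear_inv_apply, dualA, dualB, commutatorElement_def, map_mul, map_inv]
        group
      · intro k z
        rw [hb]
        simp only [β, x, y, T, Equiv.Perm.mul_apply, shearP, shearA, shearB, shear_apply,
          shear_inv_apply, dualA, dualB, commutatorElement_def, map_mul, map_inv]
        group
    intro p
    exact (hK ▸ Subgroup.mem_top p : p ∈ K)
  · intro k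
    simp only [dualA, map_mul, map_inv, ha, hb, hP k k.2.le, α, β]
    change _ = x k
    group
  · intro k
    simp only [dualB, commutatorElement_def, map_mul, map_inv, ha, hb, hP k k.2.le, α, β]
    change _ = y k
    group

/-- Poincaré duality in degree one: for an embedding of `π_g` into a group `Γ`, the cohomology
`H¹(π_g, ℤ[Γ])` is zero. -/
theorem exists_eq_sub_of_isCrossedHom {θ : SurfaceGroup g →* Γ} (hθ : Function.Injective θ)
    {d : SurfaceGroup g → MonoidAlgebra ℤ Γ} (hd : IsCrossedHom θ d) :
    ∃ w, ∀ p, d p = w - ι (θ p) * w := by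
  obtain ⟨Φ, hΦ, hΦA, hΦB⟩ := exists_shear_action θ
  obtain ⟨σ, hσ⟩ := exists_equivariant_section 0 hθ Φ hΦ
  -- The linear extension of the potential `σ`.
  let S : MonoidAlgebra ℤ Γ →+ CochainQuotient θ :=
    (Finsupp.liftAddHom fun γ => zmultiplesHom _ (σ γ)).comp
      (MonoidAlgebra.coeffAddEquiv (R := ℤ) (M := Γ)).toAddMonoidHom
  have hS : ∀ γ n, S (MonoidAlgebra.single γ n) = n • σ γ := by
    intro γ n
    change Finsupp.liftAddHom _ (Finsupp.single γ n) = _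
    simp
  have hSA : ∀ k m, S (ι (θ (dualA k)) * m) =
      S m + cochainSingle θ (Sum.inl k) (ι (θ (partialRelator g k))⁻¹ * m) := by
    intro k m
    induction m using MonoidAlgebra.induction_linear with
    | zero => simp
    | add x y hx hy =>
      rw [mul_add, mul_add, map_add, map_add, map_add, hx, hy]
      abel
    | single γ n =>
      have h := congrArg Prod.snd (hσ (dualA k) γ)
      rw [hΦA, shearA, shear_apply] at h
      simp only at h
      rw [MonoidAlgebra.of_apply, MonoidAlgebra.of_apply, MonoidAlgebra.single_mul_single,
        MonoidAlgebra.single_mul_single, one_mul, hS, hS, ← h, zsmul_add, ← map_zsmul]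
      simp
  have hSB : ∀ k m, S (ι (θ (dualB k)) * m) =
      S m + cochainSingle θ (Sum.inr k) (ι ((θ (a k))⁻¹ * (θ (partialRelator g k))⁻¹) * m) := by
    intro k m
    induction m using MonoidAlgebra.induction_linear with
    | zero => simp
    | add x y hx hy =>
      rw [mul_add, mul_add, map_add, map_add, map_add, hx, hy]
      abel
    | single γ n =>
      have h := congrArg Prod.snd (hσ (dualB k) γ)
      rw [hΦB, shearB, shear_apply] at h
      simp only at h
      rw [MonoidAlgebra.of_apply, MonoidAlgebra.of_apply, MonoidAlgebra.single_mul_single,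
        MonoidAlgebra.single_mul_single, one_mul, hS, hS, ← h, zsmul_add, ← map_zsmul]
      simp
  -- The Fox derivatives of a commutator, in terms of the dual generators.
  have hcomm : ∀ k : Fin g, ι (θ (partialRelator g k)) * d ⁅a k, b k⁆ =
      (ι (θ (partialRelator g k)) * d (a k) -
        ι (θ (dualA k)) * (ι (θ (partialRelator g k)) * d (a k))) +
      (ι (θ (partialRelator g k) * θ (a k)) * d (b k) -
        ι (θ (dualB k)) * (ι (θ (partialRelator g k) * θ (a k)) * d (b k))) := by
    intro k
    rw [commutatorElement_def, hd, hd, hd, hd.map_inv, hd.map_inv, dualA, dualB,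
      commutatorElement_def]
    have c2 : ∀ γ x, ι γ⁻¹ * (ι γ * x) = x := fun γ x => by
      rw [← mul_assoc, ← map_mul, inv_mul_cancel, map_one, one_mul]
    simp only [map_mul, map_inv, mul_assoc, mul_add, mul_neg, c2]
    abel
  have hsum : ∀ m ≤ g, S (d (partialRelator g m)) = -((List.ofFn fun k : Fin g =>
      cochainSingle θ (Sum.inl k) (d (a k)) + cochainSingle θ (Sum.inr k) (d (b k))).take m).sum := by
    intro m
    induction m with
    | zero =>
      intro _
      simp [partialRelator_zero, hd.map_one]
    | succ m ih =>
      intro hm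
      have e1 := partialRelator_succ ⟨m, hm⟩
      have e2 := hcomm ⟨m, hm⟩
      have e3 := sum_take_ofFn_succ (fun k : Fin g =>
        cochainSingle θ (Sum.inl k) (d (a k)) + cochainSingle θ (Sum.inr k) (d (b k))) ⟨m, hm⟩
      simp only at e1 e2 e3
      rw [e1, e3, hd, map_add, ih (Nat.le_of_succ_le hm), e2, map_add, map_sub, map_sub, hSA, hSB,
        ← mul_assoc, ← mul_assoc, ← map_mul ι, ← map_mul ι, ← mul_inv_rev, inv_mul_cancel,
        inv_mul_cancel, map_one, one_mul, one_mul]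
      abel
  -- For `m = g` the left side is `S (d 1) = 0`, so the family of the `d a_k`, `d b_k` has class zero.
  have hz := hsum g le_rfl
  rw [partialRelator_self, hd.map_one, map_zero, List.take_of_length_le (by simp), List.sum_ofFn,
    sum_cochainSingle, eq_comm, neg_eq_zero] at hz
  obtain ⟨w, hw⟩ := (QuotientAddGroup.eq_zero_iff _).1 hz
  refine ⟨w, ?_⟩
  let K : Subgroup (SurfaceGroup g) :=
    { carrier := {p | d p = w - ι (θ p) * w}
      one_mem' := by simp [hd.map_one, ← MonoidAlgebra.one_def]
      mul_mem' := fun {p q} hp hq => by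
        change d (p * q) = _
        rw [hd, hp, hq, map_mul, map_mul]
        noncomm_ring
      inv_mem' := fun {p} hp => by
        change d p⁻¹ = _
        rw [hd.map_inv, hp, mul_sub, ← mul_assoc, ← map_mul, ← map_mul, inv_mul_cancel, map_one,
          map_one, one_mul, neg_sub] }
  have hK : K = ⊤ := by
    apply eq_top_of_mem
    · intro k
      have := congrFun hw (Sum.inl k)
      change d (a k) = _
      rw [← one_mul w, ← mul_assoc, mul_one, ← sub_mul]
      exact this.symm
    · intro k
      have := congrFun hw (Sum.inr k)
      change d (b k) = _
      rw [← one_mul w, ← mul_assoc, mul_one, ← sub_mul]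
      exact this.symm
  intro p
  exact (hK ▸ Subgroup.mem_top p : p ∈ K)

end SurfaceGroup

end SurfaceCohomology

/-! ### The contraction and the Burnside quotients -/

section Burnside

theorem pow_eq_one_of_burnsideQuotient (N : ℕ) {G : Type*} [Group G]
    (x : BurnsideQuotient N G) : x ^ N = 1 := by
  induction x using QuotientGroup.induction_on with | H x => ?_
  exact (QuotientGroup.eq_one_iff _).2 (Subgroup.subset_normalClosure ⟨x, rfl⟩)

namespace SurfaceGroup

/-- The homomorphism from `π_g` to an abelian group that sends every `a_k` to `x` and every `b_k`
to `1`. -/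
def toCommGroup (g : ℕ) {A : Type*} [CommGroup A] (x : A) : SurfaceGroup g →* A :=
  lift (fun _ => x) (fun _ => 1)
    (CurveChainOrRing.orderedProd_one fun _ => commutatorElement_one_right x)

theorem toCommGroup_a {g : ℕ} {A : Type*} [CommGroup A] (x : A) (k : Fin g) :
    toCommGroup g x (a k) = x :=
  lift_a _ _ _ k

theorem infinite {g : ℕ} (hg : 0 < g) : Infinite (SurfaceGroup g) := by
  refine Infinite.of_surjective (toCommGroup g (Multiplicative.ofAdd (1 : ℤ))) fun n => ?_
  refine ⟨a ⟨0, hg⟩ ^ (Multiplicative.toAdd n), ?_⟩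
  rw [map_zpow, toCommGroup_a, ← ofAdd_zsmul]
  simp

theorem nontrivial_burnsideQuotient {g : ℕ} (hg : 0 < g) :
    Nontrivial (BurnsideQuotient 3 (SurfaceGroup g)) := by
  let χ := toCommGroup g (Multiplicative.ofAdd (1 : ZMod 3))
  have hle : powerSubgroup 3 (SurfaceGroup g) ≤ χ.ker := by
    apply Subgroup.normalClosure_le_normal
    rintro _ ⟨x, rfl⟩
    rw [SetLike.mem_coe, MonoidHom.mem_ker, map_pow]
    generalize χ x = y
    revert y
    decide
  refine ⟨⟨(a ⟨0, hg⟩ : SurfaceGroup g), 1, fun h => ?_⟩⟩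
  have := hle ((QuotientGroup.eq_one_iff _).1 h)
  rw [MonoidHom.mem_ker, toCommGroup_a] at this
  revert this
  decide

theorem eq_one_of_genus_zero {g : ℕ} (hg : g = 0) (x : SurfaceGroup g) : x = 1 := by
  subst hg
  have : (⊥ : Subgroup (SurfaceGroup 0)) = ⊤ := eq_top_of_mem _ (fun k => k.elim0) fun k => k.elim0
  exact Subgroup.mem_bot.1 (this ▸ Subgroup.mem_top x)

end SurfaceGroup

namespace CurveChainOrRing

variable (X : CurveChainOrRing)

/-- The free factors of `π₁(X₀)`: the groups `π₁(C_i)`, and the fundamental group of the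
intersection graph at the index `none`. -/
def Factor : Option (Fin X.n) → Type
  | none => FreeGroup (Fin X.loops)
  | some i => SurfaceGroup (X.genus i)

instance (o : Option (Fin X.n)) : Group (X.Factor o) :=
  match o with
  | none => inferInstanceAs (Group (FreeGroup (Fin X.loops)))
  | some i => inferInstanceAs (Group (SurfaceGroup (X.genus i)))

/-- `π₁(X₀)` as a free product over a single index set. -/
def toFactors : X.NodalGroup →* Monoid.CoprodI X.Factor :=
  Monoid.Coprod.lift
    (Monoid.CoprodI.lift fun i => Monoid.CoprodI.of (M := X.Factor) (i := some i))
    (Monoid.CoprodI.of (M := X.Factor) (i := none))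

/-- The inclusions of the free factors into `π₁(X₀)`. -/
def ofFactor : ∀ o, X.Factor o →* X.NodalGroup
  | none => Monoid.Coprod.inr
  | some i => X.ofComponent i

/-- The inverse of `toFactors`. -/
def fromFactors : Monoid.CoprodI X.Factor →* X.NodalGroup := Monoid.CoprodI.lift X.ofFactor

theorem fromFactors_toFactors (x : X.NodalGroup) : X.fromFactors (X.toFactors x) = x := by
  suffices X.fromFactors.comp X.toFactors = MonoidHom.id _ from DFunLike.congr_fun this x
  apply Monoid.Coprod.hom_ext
  · apply Monoid.CoprodI.ext_hom
    intro i
    ext1 k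
    exact Monoid.CoprodI.lift_of (M := X.Factor) X.ofFactor (i := some i) _
  · apply MonoidHom.ext
    intro k
    exact Monoid.CoprodI.lift_of (M := X.Factor) X.ofFactor (i := none) k

theorem toBurnside_ofComponent (i : Fin X.n) (x : SurfaceGroup (X.genus i)) :
    X.toBurnside (X.ofComponent i x) = if h : 0 < X.genus i then
      Monoid.CoprodI.of (M := fun i : {i : Fin X.n // 0 < X.genus i} =>
        BurnsideQuotient 3 (SurfaceGroup (X.genus i))) (i := ⟨i, h⟩)
          (x : BurnsideQuotient 3 (SurfaceGroup (X.genus i))) else 1 := by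
  simp only [toBurnside, ofComponent, MonoidHom.comp_apply, Monoid.Coprod.lift_apply_inl,
    Monoid.CoprodI.lift_of]
  split_ifs <;> rfl

theorem toBurnside_ofFactor_pow (o : Option (Fin X.n)) (x : X.Factor o) :
    X.toBurnside (X.ofFactor o x) ^ 3 = 1 := by
  cases o with
  | none =>
    have : X.toBurnside (X.ofFactor none x) = 1 := Monoid.Coprod.lift_apply_inr _ _ _
    rw [this, one_pow]
  | some i =>
    refine (congrArg (· ^ 3) (X.toBurnside_ofComponent i x)).trans ?_
    simp only
    split_ifs
    · rw [← map_pow, pow_eq_one_of_burnsideQuotient, map_one]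
    · rw [one_pow]

theorem ofComponent_injective (i : Fin X.n) : Function.Injective (X.ofComponent i) :=
  Monoid.Coprod.inl_injective.comp (Monoid.CoprodI.of_injective _)

/-- An automorphism of `π₁(X₀)` maps every `π₁(C_i)` into a conjugate of a free factor, hence to
elements whose cubes are trivial in the free product of the Burnside groups. -/
theorem toBurnside_aut_ofComponent_pow (ψ : MulAut X.NodalGroup) (i : Fin X.n)
    (y : SurfaceGroup (X.genus i)) : X.toBurnside (ψ (X.ofComponent i y)) ^ 3 = 1 := by
  rcases Nat.eq_zero_or_pos (X.genus i) with hg | hg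
  · rw [SurfaceGroup.eq_one_of_genus_zero hg y, map_one, map_one, map_one, one_pow]
  · have := SurfaceGroup.infinite hg
    let θ : SurfaceGroup (X.genus i) →* Monoid.CoprodI X.Factor :=
      X.toFactors.comp (ψ.toMonoidHom.comp (X.ofComponent i))
    have hθ : Function.Injective θ :=
      (Function.LeftInverse.injective X.fromFactors_toFactors).comp
        (ψ.injective.comp (X.ofComponent_injective i))
    obtain ⟨o, γ, h⟩ := Monoid.CoprodI.exists_conj_factor hθ fun d hd =>
      SurfaceGroup.exists_eq_sub_of_isCrossedHom hθ hd
    obtain ⟨z, hz⟩ := h y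
    have e : ψ (X.ofComponent i y) =
        X.fromFactors γ * X.ofFactor o z * (X.fromFactors γ)⁻¹ := by
      have h1 : X.ofFactor o z = X.fromFactors (Monoid.CoprodI.of z) :=
        (Monoid.CoprodI.lift_of X.ofFactor z).symm
      rw [h1, hz, ← map_inv, ← map_mul, ← map_mul]
      rw [show γ * (γ⁻¹ * θ y * γ) * γ⁻¹ = θ y by group]
      exact (X.fromFactors_toFactors _).symm
    rw [e, map_mul, map_mul, map_inv, conj_pow, X.toBurnside_ofFactor_pow, mul_one,
      mul_inv_cancel]

theorem contraction_a_handle (i : Fin X.n) (j : Fin (X.genus i)) :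
    X.contraction (SurfaceGroup.a (X.handle i j)) = X.ofComponent i (SurfaceGroup.a j) :=
  (SurfaceGroup.lift_a _ _ _ _).trans (X.onHandles_handle _ _ i j)

theorem contraction_b_handle (i : Fin X.n) (j : Fin (X.genus i)) :
    X.contraction (SurfaceGroup.b (X.handle i j)) = X.ofComponent i (SurfaceGroup.b j) :=
  (SurfaceGroup.lift_b _ _ _ _).trans (X.onHandles_handle _ _ i j)

theorem contraction_b_loopHandle (l : Fin X.loops) :
    X.contraction (SurfaceGroup.b (X.loopHandle l)) = 1 :=
  (SurfaceGroup.lift_b _ _ _ _).trans (X.onHandles_loopHandle _ _ l)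

theorem contraction_handleProd (i : Fin X.n) : X.contraction (X.handleProd i) = 1 := by
  rw [handleProd, map_orderedProd]
  simp only [map_commutatorElement, contraction_a_handle, contraction_b_handle]
  simp only [← map_commutatorElement]
  rw [← map_orderedProd, SurfaceGroup.relation, map_one]

theorem contraction_nodeCycle (k : ℕ) : X.contraction (X.nodeCycle k) = 1 := by
  rw [nodeCycle, map_mul, map_list_prod, map_list_prod, List.prod_eq_one, List.prod_eq_one,
    one_mul]
  · intro x hx
    obtain ⟨y, hy, rfl⟩ := List.mem_map.1 hx
    obtain ⟨i, rfl⟩ := (List.mem_ofFn' _ _).1 (List.mem_of_mem_take hy)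
    exact X.contraction_handleProd i
  · intro x hx
    obtain ⟨y, hy, rfl⟩ := List.mem_map.1 hx
    obtain ⟨l, rfl⟩ := (List.mem_ofFn' _ _).1 hy
    rw [map_inv, contraction_b_loopHandle, inv_one]

theorem contraction_mem_range_ofComponent (i : Fin X.n) {s : X.FiberGroup}
    (hs : s ∈ X.componentSubgroup i) : X.contraction s ∈ (X.ofComponent i).range := by
  suffices X.componentSubgroup i ≤ (X.ofComponent i).range.comap X.contraction from this hs
  rw [componentSubgroup, Subgroup.closure_le]
  rintro x (⟨j, rfl | rfl⟩ | rfl | rfl)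
  · exact ⟨_, (X.contraction_a_handle i j).symm⟩
  · exact ⟨_, (X.contraction_b_handle i j).symm⟩
  · exact ⟨1, by rw [contraction_nodeCycle, map_one]⟩
  · exact ⟨1, by rw [contraction_nodeCycle, map_one]⟩

theorem toBurnside_contraction_surjective :
    Function.Surjective (X.toBurnside.comp X.contraction) := by
  rw [← MonoidHom.range_eq_top, eq_top_iff]
  rintro x -
  induction x using Monoid.CoprodI.induction_on with
  | one => exact one_mem _
  | mul x y hx hy => exact mul_mem hx hy
  | of i x =>
    obtain ⟨i, hi⟩ := i
    induction x using QuotientGroup.induction_on with | H x => ?_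
    have hof : ∀ y : SurfaceGroup (X.genus i), X.toBurnside (X.ofComponent i y) =
        Monoid.CoprodI.of (M := fun i : {i : Fin X.n // 0 < X.genus i} =>
        BurnsideQuotient 3 (SurfaceGroup (X.genus i))) (i := ⟨i, hi⟩)
          (y : BurnsideQuotient 3 (SurfaceGroup (X.genus i))) := fun y => by
      rw [toBurnside_ofComponent, dif_pos hi]
    rw [← hof]
    have hK : (X.toBurnside.comp X.contraction).range.comap
        (X.toBurnside.comp (X.ofComponent i)) = ⊤ := by
      apply SurfaceGroup.eq_top_of_mem
      · intro k
        exact ⟨_, congrArg X.toBurnside (X.contraction_a_handle i k)⟩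
      · intro k
        exact ⟨_, congrArg X.toBurnside (X.contraction_b_handle i k)⟩
    exact (hK ▸ Subgroup.mem_top x :
      x ∈ (X.toBurnside.comp X.contraction).range.comap (X.toBurnside.comp (X.ofComponent i)))

/-- Every automorphism that represents an element of `M_D` commutes with the contraction, since
inner automorphisms do. -/
theorem mem_compatibleAut_of_mem_MD {φ : MulAut X.FiberGroup}
    (h : (φ : MappingClassGroup X.arithGenus) ∈ X.MD) : φ ∈ X.compatibleAut := by
  obtain ⟨φ', hφ', e⟩ := h
  obtain ⟨x, hx⟩ := QuotientGroup.eq.1 e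
  rw [← mul_inv_cancel_left φ' φ, ← hx]
  refine mul_mem hφ' ⟨MulAut.conj (X.contraction x), fun y => ?_⟩
  simp [MulAut.conj_apply]

theorem burnsideKernel_le_ker (S₁ : Set X.FiberGroup)
    (hS₁ : ∀ s ∈ S₁, ∃ i : Fin X.n, ∃ u : X.FiberGroup, u * s * u⁻¹ ∈ X.componentSubgroup i) :
    burnsideKernel X.MD (X.vanishingCycles ∪ S₁) 3 ≤ (X.toBurnside.comp X.contraction).ker := by
  apply Subgroup.normalClosure_le_normal
  rintro _ ⟨s, hs, φ, hφ, rfl⟩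
  obtain ⟨ψ, hψ⟩ := X.mem_compatibleAut_of_mem_MD hφ
  rw [SetLike.mem_coe, MonoidHom.mem_ker, map_pow, MonoidHom.comp_apply, hψ]
  rcases hs with ⟨k, -, -, rfl⟩ | hs
  · rw [contraction_nodeCycle, map_one, map_one, one_pow]
  · obtain ⟨i, u, hu⟩ := hS₁ s hs
    obtain ⟨y, hy⟩ := X.contraction_mem_range_ofComponent i hu
    have e : X.contraction s = (X.contraction u)⁻¹ * X.ofComponent i y * (X.contraction u) := by
      rw [hy, ← map_inv, ← map_mul, ← map_mul]
      congr 1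
      group
    have := conj_pow (i := 3) (a := (X.toBurnside (ψ (X.contraction u)))⁻¹)
      (b := X.toBurnside (ψ (X.ofComponent i y)))
    rw [toBurnside_aut_ofComponent_pow, mul_one, mul_inv_cancel, inv_inv] at this
    rw [e, map_mul, map_mul, map_mul, map_mul, map_inv, map_inv, this]

end CurveChainOrRing

end Burnside

theorem lemma4p3 (X : CurveChainOrRing)
    (hX : ∃ i j : Fin X.n, i ≠ j ∧ 0 < X.genus i ∧ 0 < X.genus j)
    (S₁ : Set X.FiberGroup)
    (hS₁ : ∀ s ∈ S₁, ∃ i : Fin X.n, ∃ u : X.FiberGroup, u * s * u⁻¹ ∈ X.componentSubgroup i) :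
    Infinite (BurnsideTypeQuotient X.MD (X.vanishingCycles ∪ S₁) 3) ∧
    (∀ i : Fin X.n, 0 < X.genus i → Nontrivial (BurnsideQuotient 3 (SurfaceGroup (X.genus i)))) ∧
    ∃ f : BurnsideTypeQuotient X.MD (X.vanishingCycles ∪ S₁) 3 →* X.BurnsideFreeProduct,
      Function.Surjective f ∧
      ∀ x : X.FiberGroup, f (x : BurnsideTypeQuotient X.MD (X.vanishingCycles ∪ S₁) 3) =
        X.toBurnside (X.contraction x) := by
  let f : BurnsideTypeQuotient X.MD (X.vanishingCycles ∪ S₁) 3 →* X.BurnsideFreeProduct :=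
    QuotientGroup.lift _ (X.toBurnside.comp X.contraction) (X.burnsideKernel_le_ker S₁ hS₁)
  have hf : Function.Surjective f := fun y =>
    let ⟨x, hx⟩ := X.toBurnside_contraction_surjective y
    ⟨x, hx⟩
  refine ⟨?_, fun i hi => SurfaceGroup.nontrivial_burnsideQuotient hi, f, hf, fun x => rfl⟩
  obtain ⟨i, j, hij, hi, hj⟩ := hX
  have := SurfaceGroup.nontrivial_burnsideQuotient hi
  have := SurfaceGroup.nontrivial_burnsideQuotient hj
  have : Infinite X.BurnsideFreeProduct :=
    Monoid.CoprodI.infinite (G := fun i : {i : Fin X.n // 0 < X.genus i} =>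
      BurnsideQuotient 3 (SurfaceGroup (X.genus i))) (i := ⟨i, hi⟩) (j := ⟨j, hj⟩)
      (fun h => hij (congrArg Subtype.val h))
  exact Infinite.of_surjective f hf
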